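/- Let $n \ge 1$ be an integer and let $p$ be an odd prime with $p > \frac{n+1}{2}$. Let $B_k$ denote the Bernoulli numbers, defined by $\frac{x}{e^x-1} = \sum_{k\ge 0} B_k \frac{x^k}{k!}$, let $H^{(m)}_{N} = \sum_{k=1}^{N} \frac{1}{k^m}$ be the generalized harmonic numbers, and let $q_p = \frac{2^{p-1}-1}{p}$ be the base-$2$ Fermat quotient. Then $$\sum_{j=0}^{n-1}\frac{(2^{j+1}-1)(2^{j+2}-1)\,B_{j+2}}{(j+1)(j+2)\,2^{j-1}}\,H^{(j+1)}_{\frac{p-1}{2}}\,p^j+\sum_{j=0}^{n-1}(-1)^j\,\frac{q_p^{\,j+1}}{j+1}\,p^j\equiv 0 \pmod{p^n},$$ where, for rational numbers $x,y$, $x \equiv y \pmod{p^n}$ means that $x-y = p^n\,\frac{a}{b}$ for some integers $a,b$ with $p \nmid b$. -/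

import Mathlib

/-- The generalized harmonic number `∑_{k=1}^{N} 1 / k ^ m`. -/
def genHarmonic (m N : ℕ) : ℚ :=
  ∑ k ∈ Finset.Icc 1 N, 1 / (k : ℚ) ^ m

/-- The base-2 Fermat quotient `(2 ^ (p - 1) - 1) / p`. -/
def fermatQuotientTwo (p : ℕ) : ℚ :=
  ((2 : ℚ) ^ (p - 1) - 1) / (p : ℚ)

/-- Congruence of rational numbers modulo `p ^ n`: the difference `x - y` is `p ^ n` times a
`p`-integral rational, i.e. a fraction whose denominator is not divisible by `p`. -/
def RatModEqPrimePow (p n : ℕ) (x y : ℚ) : Prop :=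
  ∃ a b : ℤ, ¬ (p : ℤ) ∣ b ∧ x - y = (p : ℚ) ^ n * ((a : ℚ) / (b : ℚ))

/-- The value at `0` of the `m`-th Euler polynomial, expressed through Bernoulli numbers. -/
def eulerPolyZero (m : ℕ) : ℚ :=
  -2 * (2 ^ (m + 1) - 1) * bernoulli (m + 1) / (m + 1)

theorem eulerPolyZero_zero : eulerPolyZero 0 = 1 := by
  norm_num [eulerPolyZero, bernoulli_one]

theorem eulerPolyZero_eq_zero_of_even {m : ℕ} (hm : Even m) (h0 : m ≠ 0) :
    eulerPolyZero m = 0 := by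
  rw [eulerPolyZero, bernoulli_eq_zero_of_odd hm.add_one (by omega)]
  simp

theorem X_mul_eulerPolyZero_powerSeries :
    PowerSeries.X * PowerSeries.mk (fun m => eulerPolyZero m / (m.factorial : ℚ)) =
      2 * (bernoulliPowerSeries ℚ - PowerSeries.rescale 2 (bernoulliPowerSeries ℚ)) := by
  have h2 : (2 : PowerSeries ℚ) = PowerSeries.C 2 := (map_ofNat PowerSeries.C 2).symm
  ext m
  rw [h2, PowerSeries.coeff_C_mul]
  cases m with
  | zero => rw [map_sub, PowerSeries.coeff_rescale]; simp
  | succ m =>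
    rw [mul_comm, PowerSeries.coeff_succ_mul_X]
    simp only [bernoulliPowerSeries, PowerSeries.coeff_mk, map_sub, PowerSeries.coeff_rescale,
      eulerPolyZero, Nat.factorial_succ, Algebra.algebraMap_self, RingHom.id_apply]
    have : (m.factorial : ℚ) ≠ 0 := by exact_mod_cast m.factorial_ne_zero
    have : (m : ℚ) + 1 ≠ 0 := by positivity
    push_cast
    field_simp
    ring

theorem eulerPolyZero_powerSeries_mul :
    PowerSeries.mk (fun m => eulerPolyZero m / (m.factorial : ℚ)) * (PowerSeries.exp ℚ + 1) =
      2 := by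
  set W := PowerSeries.mk (fun m => eulerPolyZero m / (m.factorial : ℚ)) with hW
  have hX := X_mul_eulerPolyZero_powerSeries
  rw [← hW] at hX
  have hb := bernoulliPowerSeries_mul_exp_sub_one ℚ
  have hb2 : PowerSeries.rescale 2 (bernoulliPowerSeries ℚ) * (PowerSeries.exp ℚ ^ 2 - 1) =
      2 * PowerSeries.X := by
    have h := congrArg (PowerSeries.rescale (2 : ℚ)) hb
    rw [map_mul, map_sub, map_one, PowerSeries.rescale_X, map_ofNat] at h
    rw [PowerSeries.exp_pow_eq_rescale_exp]
    simpa using h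
  have hne : PowerSeries.X * (PowerSeries.exp ℚ - 1) ≠ 0 := by
    refine mul_ne_zero PowerSeries.X_ne_zero fun h => ?_
    rw [h, mul_zero] at hb
    exact PowerSeries.X_ne_zero hb.symm
  apply mul_left_cancel₀ hne
  linear_combination (PowerSeries.exp ℚ ^ 2 - 1) * hX + 2 * (PowerSeries.exp ℚ + 1) * hb - 2 * hb2

theorem sum_choose_mul_eulerPolyZero {d : ℕ} (hd : d ≠ 0) :
    ∑ k ∈ Finset.range (d + 1), (d.choose k : ℚ) * eulerPolyZero k = -eulerPolyZero d := by
  have h := congrArg (PowerSeries.coeff d) eulerPolyZero_powerSeries_mul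
  have h2 : PowerSeries.coeff d (2 : PowerSeries ℚ) = 0 := by
    have : (2 : PowerSeries ℚ) = PowerSeries.C 2 := (map_ofNat PowerSeries.C 2).symm
    rw [this, PowerSeries.coeff_C, if_neg hd]
  have hf : ∀ k : ℕ, (k.factorial : ℚ) ≠ 0 := fun k => by exact_mod_cast k.factorial_ne_zero
  rw [h2, mul_add, mul_one, map_add, PowerSeries.coeff_mul, PowerSeries.coeff_mk,
    Finset.Nat.sum_antidiagonal_eq_sum_range_succ_mk] at h
  have h3 : ∑ k ∈ Finset.range (d + 1), (d.choose k : ℚ) * eulerPolyZero k =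
      (d.factorial : ℚ) * ∑ k ∈ Finset.range d.succ,
        PowerSeries.coeff k (PowerSeries.mk fun m => eulerPolyZero m / (m.factorial : ℚ)) *
          PowerSeries.coeff (d - k) (PowerSeries.exp ℚ) := by
    rw [Finset.mul_sum]
    refine Finset.sum_congr rfl fun k hk => ?_
    rw [Nat.cast_choose ℚ (Nat.lt_succ_iff.mp (Finset.mem_range.mp hk)), PowerSeries.coeff_mk,
      PowerSeries.coeff_exp]
    have := hf k
    have := hf (d - k)
    simp only [Algebra.algebraMap_self, RingHom.id_apply]
    field_simp
  rw [h3, eq_neg_of_add_eq_zero_left h]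
  have := hf d
  field_simp

theorem eulerPolyZero_eq_sum {d : ℕ} (hd : d ≠ 0) :
    eulerPolyZero d =
      -(∑ k ∈ Finset.range d, (d.choose k : ℚ) * eulerPolyZero k) / 2 := by
  have h := sum_choose_mul_eulerPolyZero hd
  rw [Finset.sum_range_succ, Nat.choose_self, Nat.cast_one] at h
  linarith

/-- The coefficient `(1 + 2 E_{j+1}(0)) / (j + 1)`. -/
def invariantCoeff (j : ℕ) : ℚ := (1 + 2 * eulerPolyZero (j + 1)) / (j + 1)

theorem sum_neg_one_pow_mul_choose_mul_invariantCoeff (d : ℕ) :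
    ∑ j ∈ Finset.range (d + 1), (-1) ^ (j + 1) * (d.choose j : ℚ) * invariantCoeff j =
      invariantCoeff d := by
  have hd : (d : ℚ) + 1 ≠ 0 := by positivity
  have hterm : ∀ j ∈ Finset.range (d + 1),
      (-1) ^ (j + 1) * (d.choose j : ℚ) * invariantCoeff j =
        ((-1) ^ (j + 1) * ((d + 1).choose (j + 1) : ℚ)
          - 2 * (((d + 1).choose (j + 1) : ℚ) * eulerPolyZero (j + 1))) / (d + 1) := by
    intro j _
    have hc : ((d : ℚ) + 1) * d.choose j = (d + 1).choose (j + 1) * (j + 1) := by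
      exact_mod_cast Nat.add_one_mul_choose_eq d j
    have hE : (-1) ^ (j + 1) * eulerPolyZero (j + 1) = -eulerPolyZero (j + 1) := by
      rcases Nat.even_or_odd (j + 1) with h | h
      · rw [eulerPolyZero_eq_zero_of_even h (by omega)]; simp
      · rw [h.neg_one_pow]; ring
    have hj : (j : ℚ) + 1 ≠ 0 := by positivity
    rw [invariantCoeff]
    field_simp
    linear_combination (-1) ^ (j + 1) * (1 + 2 * eulerPolyZero (j + 1)) * hc +
      2 * ((d + 1).choose (j + 1) : ℚ) * (j + 1) * hE
  rw [Finset.sum_congr rfl hterm, ← Finset.sum_div, Finset.sum_sub_distrib, ← Finset.mul_sum]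
  have h1 := sum_choose_mul_eulerPolyZero (d := d + 1) (by omega)
  rw [Finset.sum_range_succ', Nat.choose_zero_right, eulerPolyZero_zero] at h1
  have h2 : ∑ j ∈ Finset.range (d + 1 + 1), (-1 : ℚ) ^ j * ((d + 1).choose j : ℚ) = 0 := by
    have h := Int.alternating_sum_range_choose (n := d + 1)
    rw [if_neg (by omega)] at h
    exact_mod_cast h
  rw [Finset.sum_range_succ'] at h2
  rw [invariantCoeff]
  simp only [Nat.choose_zero_right, pow_zero, Nat.cast_one] at h1 h2
  congr 1
  linarith

theorem one_sub_mul_sum_choose_mul_pow {R : Type*} [CommRing R] (t : R) (j n : ℕ) :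
    (1 - t) * ∑ d ∈ Finset.range n, (d.choose (j + 1) : R) * t ^ (d + 1) =
      t * ∑ d ∈ Finset.range n, (d.choose j : R) * t ^ (d + 1) -
        (n.choose (j + 1) : R) * t ^ (n + 1) := by
  induction n with
  | zero => simp
  | succ n ih =>
    rw [Finset.sum_range_succ, Finset.sum_range_succ, mul_add, ih, Nat.choose_succ_succ' n j]
    push_cast
    ring

theorem pow_succ_dvd_pow_sub_sum_choose {R : Type*} [CommRing R] {t w : R}
    (hw : w * (1 - t) = 1) (n j : ℕ) :
    t ^ (n + 1) ∣ (t * w) ^ (j + 1) - ∑ d ∈ Finset.range n, (d.choose j : R) * t ^ (d + 1) := by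
  induction j with
  | zero =>
    refine ⟨w, ?_⟩
    have h := mul_neg_geom_sum t n
    have hs : ∑ d ∈ Finset.range n, (d.choose 0 : R) * t ^ (d + 1) =
        t * ∑ d ∈ Finset.range n, t ^ d := by
      rw [Finset.mul_sum]
      exact Finset.sum_congr rfl fun d _ => by simp [pow_succ']
    rw [hs]
    linear_combination (t * ∑ d ∈ Finset.range n, t ^ d) * hw - t * w * h
  | succ j ih =>
    obtain ⟨c, hc⟩ := ih
    have h := one_sub_mul_sum_choose_mul_pow t j n
    refine ⟨w * t * c + w * n.choose (j + 1), ?_⟩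
    linear_combination
      (∑ d ∈ Finset.range n, (d.choose (j + 1) : R) * t ^ (d + 1)) * hw - w * h + w * t * hc

/-- A truncated power series invariant under `t ↦ t / (t - 1)` up to order `n` takes congruent
values at `t` and `t / (t - 1)`. -/
theorem pow_succ_dvd_sum_sub_sum_of_invariant {R : Type*} [CommRing R] {t w : R}
    (hw : w * (1 - t) = 1) (n : ℕ) (g : ℕ → R)
    (hg : ∀ d < n, ∑ j ∈ Finset.range (d + 1), (-1) ^ (j + 1) * (d.choose j : R) * g j = g d) :
    t ^ (n + 1) ∣ ∑ j ∈ Finset.range n, g j * (-(t * w)) ^ (j + 1) -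
      ∑ j ∈ Finset.range n, g j * t ^ (j + 1) := by
  have hswap : ∑ j ∈ Finset.range n, g j * t ^ (j + 1) =
      ∑ j ∈ Finset.range n, g j * (-1) ^ (j + 1) *
        ∑ d ∈ Finset.range n, (d.choose j : R) * t ^ (d + 1) := by
    simp_rw [Finset.mul_sum]
    rw [Finset.sum_comm]
    refine Finset.sum_congr rfl fun d hd => ?_
    have hd := Finset.mem_range.mp hd
    rw [← hg d hd, Finset.sum_mul]
    rw [← Finset.sum_subset (Finset.range_mono (show d + 1 ≤ n by omega))]
    · exact Finset.sum_congr rfl fun j _ => by ring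
    · intro j _ hj
      rw [Nat.choose_eq_zero_of_lt (by simpa using hj)]
      simp
  rw [hswap, ← Finset.sum_sub_distrib]
  refine Finset.dvd_sum fun j _ => ?_
  obtain ⟨c, hc⟩ := pow_succ_dvd_pow_sub_sum_choose hw n j
  refine ⟨g j * (-1) ^ (j + 1) * c, ?_⟩
  rw [neg_pow (t * w)]
  linear_combination g j * (-1) ^ (j + 1) * hc

@[to_additive]
theorem prod_Icc_mul_reflect_eq {M : Type*} [CommMonoid M] (f : ℕ → M) (m : ℕ) :
    ∏ k ∈ Finset.Icc 1 m, f k * f (2 * m + 1 - k) =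
      ∏ k ∈ Finset.Icc 1 m, f (2 * k) * f (2 * m + 1 - 2 * k) := by
  have hl : ∏ k ∈ Finset.Icc 1 m, f k * f (2 * m + 1 - k) =
      ∏ k ∈ Finset.Icc 1 (2 * m), f k := by
    rw [Finset.prod_mul_distrib]
    have : Finset.Icc 1 (2 * m) = Finset.Icc 1 m ∪ Finset.Icc (m + 1) (2 * m) := by
      ext; simp; omega
    rw [this, Finset.prod_union (by
      rw [Finset.disjoint_left]; intro a; simp only [Finset.mem_Icc]; omega)]
    congr 1
    refine Finset.prod_nbij' (fun k => 2 * m + 1 - k) (fun k => 2 * m + 1 - k) ?_ ?_ ?_ ?_ ?_ <;>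
      intro k hk <;> simp only [Finset.mem_Icc] at hk ⊢ <;> omega
  have hr : ∏ k ∈ Finset.Icc 1 m, f (2 * k) * f (2 * m + 1 - 2 * k) =
      ∏ k ∈ Finset.Icc 1 (2 * m), f k := by
    rw [Finset.prod_mul_distrib, ← Finset.prod_filter_mul_prod_filter_not (Finset.Icc 1 (2 * m)) (fun k => Even k)]
    congr 1
    · refine Finset.prod_nbij' (fun k => 2 * k) (fun k => k / 2) ?_ ?_ ?_ ?_ ?_ <;>
        intro k hk <;> simp only [Finset.mem_Icc, Finset.mem_filter, Nat.even_iff] at hk ⊢ <;>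
        omega
    · refine Finset.prod_nbij' (fun k => 2 * m + 1 - 2 * k) (fun k => (2 * m + 1 - k) / 2)
        ?_ ?_ ?_ ?_ ?_ <;>
        intro k hk <;> simp only [Finset.mem_Icc, Finset.mem_filter, Nat.even_iff] at hk ⊢ <;>
        omega
  rw [hl, hr]

section

open Polynomial

/-- The truncation `∑_{i=1}^{n} (-1)^(i-1) z^i / i` of the series of `log (1 + z)`. -/
def truncLog {A : Type*} [CommRing A] [Algebra ℚ A] (n : ℕ) (z : A) : A :=
  ∑ j ∈ Finset.range n, algebraMap ℚ A ((-1) ^ j / (j + 1)) * z ^ (j + 1)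

theorem eval_truncLog (n : ℕ) (f : ℚ[X]) (x : ℚ) :
    (truncLog n f).eval x = truncLog n (f.eval x) := by
  simp [truncLog, eval_finsetSum, Polynomial.algebraMap_eq]

theorem one_add_mul_derivative_truncLog (n : ℕ) (f : ℚ[X]) :
    (1 + f) * derivative (truncLog n f) = (1 - (-f) ^ n) * derivative f := by
  have h : derivative (truncLog n f) = (∑ j ∈ Finset.range n, (-f) ^ j) * derivative f := by
    rw [truncLog, derivative_sum, Finset.sum_mul]
    refine Finset.sum_congr rfl fun j _ => ?_
    have hj : (j : ℚ) + 1 ≠ 0 := by positivity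
    rw [Polynomial.algebraMap_eq, derivative_C_mul, derivative_pow_succ, neg_pow f,
      show ((-1 : ℚ[X]) ^ j) = C ((-1 : ℚ) ^ j / (j + 1)) * C ((j : ℚ) + 1) by
        rw [← C_mul, div_mul_cancel₀ _ hj]; simp]
    ring
  have hg := mul_neg_geom_sum (-f) n
  rw [h]
  linear_combination derivative f * hg

theorem X_pow_succ_dvd_of_derivative {f : ℚ[X]} {n : ℕ} (h0 : f.coeff 0 = 0)
    (hd : X ^ n ∣ derivative f) : X ^ (n + 1) ∣ f := by
  rw [X_pow_dvd_iff] at hd ⊢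
  intro d hdn
  cases d with
  | zero => exact h0
  | succ d =>
    have h := hd d (by omega)
    rw [coeff_derivative] at h
    exact (mul_eq_zero.mp h).resolve_right (by positivity)

/-- Additivity of the truncated logarithm, as a polynomial identity to order `n`. -/
theorem X_pow_succ_dvd_truncLog_add (n : ℕ) (a b : ℚ) :
    X ^ (n + 1) ∣ truncLog n (C a * X + C b * X + C a * X * (C b * X)) -
      truncLog n (C a * X) - truncLog n (C b * X) := by
  set u : ℚ[X] := C a * X with hu
  set v : ℚ[X] := C b * X with hv
  have hXu : X ∣ u := Dvd.intro_left _ rfl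
  have hXv : X ∣ v := Dvd.intro_left _ rfl
  have hXw : X ∣ u + v + u * v := dvd_add (dvd_add hXu hXv) (hXu.mul_right v)
  have hpow : ∀ z : ℚ[X], X ∣ z → X ^ n ∣ (-z) ^ n := fun z hz =>
    pow_dvd_pow_of_dvd ((dvd_neg).mpr hz) n
  apply X_pow_succ_dvd_of_derivative
  · rw [coeff_zero_eq_eval_zero]
    simp only [eval_sub, eval_truncLog]
    simp [hu, hv, truncLog]
  · have hcop : IsCoprime (X ^ n : ℚ[X]) ((1 + u) * (1 + v)) := by
      apply IsCoprime.pow_left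
      obtain ⟨c, hc⟩ := hXw
      exact ⟨-c, 1, by linear_combination hc⟩
    apply hcop.dvd_of_dvd_mul_left
    have h1 := one_add_mul_derivative_truncLog n u
    have h2 := one_add_mul_derivative_truncLog n v
    have h3 := one_add_mul_derivative_truncLog n (u + v + u * v)
    have key : (1 + u) * (1 + v) * derivative (truncLog n (u + v + u * v) -
        truncLog n u - truncLog n v) = (-u) ^ n * ((1 + v) * derivative u) +
        (-v) ^ n * ((1 + u) * derivative v) -
        (-(u + v + u * v)) ^ n * derivative (u + v + u * v) := by
      have hd : derivative (u + v + u * v) =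
          (1 + v) * derivative u + (1 + u) * derivative v := by
        simp only [derivative_add, derivative_mul (f := u)]; ring
      rw [derivative_sub, derivative_sub]
      linear_combination h3 - (1 + v) * h1 - (1 + u) * h2 + hd
    rw [key]
    exact dvd_sub (dvd_add ((hpow u hXu).mul_right _) ((hpow v hXv).mul_right _))
      ((hpow _ hXw).mul_right _)

/-- The subring of `ℚ` of fractions with denominator prime to `p`. -/
def primeIntegral (p : ℕ) [hp : Fact p.Prime] : Subring ℚ where
  carrier := {x | ∃ a b : ℤ, ¬ (p : ℤ) ∣ b ∧ x = a / b}
  zero_mem' := ⟨0, 1, by exact_mod_cast hp.out.not_dvd_one, by simp⟩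
  one_mem' := ⟨1, 1, by exact_mod_cast hp.out.not_dvd_one, by simp⟩
  neg_mem' := by
    rintro _ ⟨a, b, hb, rfl⟩
    exact ⟨-a, b, hb, by push_cast; ring⟩
  mul_mem' := by
    rintro _ _ ⟨a, b, hb, rfl⟩ ⟨c, d, hd, rfl⟩
    refine ⟨a * c, b * d, (Nat.prime_iff_prime_int.mp hp.out).not_dvd_mul hb hd, ?_⟩
    push_cast
    rw [div_mul_div_comm]
  add_mem' := by
    rintro _ _ ⟨a, b, hb, rfl⟩ ⟨c, d, hd, rfl⟩
    refine ⟨a * d + b * c, b * d, (Nat.prime_iff_prime_int.mp hp.out).not_dvd_mul hb hd, ?_⟩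
    have hb0 : (b : ℚ) ≠ 0 := by rintro h; exact hb (by simp [Int.cast_eq_zero.mp h])
    have hd0 : (d : ℚ) ≠ 0 := by rintro h; exact hd (by simp [Int.cast_eq_zero.mp h])
    push_cast
    rw [div_add_div _ _ hb0 hd0]

variable {p : ℕ} [hp : Fact p.Prime]

theorem inv_intCast_mem_primeIntegral {k : ℤ} (hk : ¬ (p : ℤ) ∣ k) :
    ((k : ℚ))⁻¹ ∈ primeIntegral p := ⟨1, k, hk, by simp⟩

theorem inv_natCast_mem_primeIntegral {k : ℕ} (hk : ¬ p ∣ k) :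
    ((k : ℚ))⁻¹ ∈ primeIntegral p := by
  have := inv_intCast_mem_primeIntegral (p := p) (k := k) (by exact_mod_cast hk)
  simpa using this

variable (p) in
/-- The additive group of rationals divisible by `p ^ n` among the `p`-integral ones. -/
def primePowMultiples (n : ℕ) : AddSubgroup ℚ :=
  (primeIntegral p).toAddSubgroup.map (AddMonoidHom.mulLeft ((p : ℚ) ^ n))

theorem mem_primePowMultiples {n : ℕ} {x : ℚ} :
    x ∈ primePowMultiples p n ↔ ∃ s ∈ primeIntegral p, (p : ℚ) ^ n * s = x := Iff.rfl

theorem mul_mem_primePowMultiples {n : ℕ} {x s : ℚ} (hs : s ∈ primeIntegral p)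
    (hx : x ∈ primePowMultiples p n) : s * x ∈ primePowMultiples p n := by
  obtain ⟨r, hr, rfl⟩ := hx
  exact mem_primePowMultiples.mpr ⟨s * r, mul_mem hs hr, by simp; ring⟩

theorem eval_mem_primePowMultiples {n : ℕ} {f : ℚ[X]}
    (hf : ∀ d, f.coeff d ∈ primeIntegral p) (hX : X ^ n ∣ f) :
    f.eval (p : ℚ) ∈ primePowMultiples p n := by
  obtain ⟨g, rfl⟩ := hX
  refine mem_primePowMultiples.mpr ⟨g.eval (p : ℚ), ?_, by simp⟩
  rw [eval_eq_sum_range]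
  refine sum_mem fun d _ => mul_mem ?_ (pow_mem (natCast_mem _ _) _)
  simpa [coeff_X_pow_mul] using hf (d + n)

/-- Up to a multiple of `(u v)^p / p`, the polynomial `((u + v + u v)^i - u^i - v^i) / i` is
integral for `0 < i < 2 p`. -/
theorem exists_integral_part {i : ℕ} (hi0 : i ≠ 0) (hi : i < 2 * p) {u v : ℚ[X]}
    (hu : u ∈ liftsRing (primeIntegral p).subtype) (hv : v ∈ liftsRing (primeIntegral p).subtype) :
    ∃ g ∈ liftsRing (primeIntegral p).subtype, ∃ e ∈ primeIntegral p,
      C ((i : ℚ)⁻¹) * ((u + v + u * v) ^ i - u ^ i - v ^ i) =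
        g + C (e / p) * (u * v) ^ p := by
  have hC : ∀ c ∈ primeIntegral p, C c ∈ liftsRing (primeIntegral p).subtype := fun c hc => by
    rw [← lifts_iff_liftsRing]; exact C_mem_lifts _ (⟨c, hc⟩ : primeIntegral p)
  by_cases h : p ∣ i
  · obtain rfl : i = p := by
      obtain ⟨c, rfl⟩ := h
      have : c < 2 := by
        by_contra hc
        have := Nat.mul_le_mul_left p (not_lt.mp hc)
        omega
      interval_cases c <;> simp_all
    obtain ⟨r, hr⟩ := exists_add_pow_prime_eq hp.out
      (⟨u, hu⟩ + ⟨v, hv⟩ : liftsRing (primeIntegral i).subtype) (⟨u, hu⟩ * ⟨v, hv⟩)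
    obtain ⟨s, hs⟩ := exists_add_pow_prime_eq hp.out
      (⟨u, hu⟩ : liftsRing (primeIntegral i).subtype) ⟨v, hv⟩
    have hr' := congrArg Subtype.val hr
    have hs' := congrArg Subtype.val hs
    push_cast at hr' hs'
    refine ⟨(u + v) * (u * v) * r + u * v * s, ?_, 1, one_mem _, ?_⟩
    · exact add_mem (mul_mem (mul_mem (add_mem hu hv) (mul_mem hu hv)) r.2)
        (mul_mem (mul_mem hu hv) s.2)
    · have hp0 : (i : ℚ) ≠ 0 := by exact_mod_cast hi0
      have hc : C ((i : ℚ)⁻¹) * (i : ℚ[X]) = 1 := by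
        rw [← C_eq_natCast, ← C_mul, inv_mul_cancel₀ hp0, C_1]
      rw [one_div]
      linear_combination C ((i : ℚ)⁻¹) * hr' + C ((i : ℚ)⁻¹) * hs' +
        ((u + v) * (u * v) * r + u * v * s) * hc
  · refine ⟨_, mul_mem (hC _ (inv_natCast_mem_primeIntegral h))
      (sub_mem (sub_mem (pow_mem (add_mem (add_mem hu hv) (mul_mem hu hv)) i) (pow_mem hu i))
        (pow_mem hv i)), 0, zero_mem _, by simp⟩

theorem truncLog_add_mem {n : ℕ} (hn : n + 2 ≤ 2 * p) {x y : ℚ}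
    (hx : x ∈ primePowMultiples p 1) (hy : y ∈ primePowMultiples p 1) :
    truncLog n (x + y + x * y) - truncLog n x - truncLog n y ∈ primePowMultiples p (n + 1) := by
  obtain ⟨a, ha, rfl⟩ := mem_primePowMultiples.mp hx
  obtain ⟨b, hb, rfl⟩ := mem_primePowMultiples.mp hy
  have hlin : ∀ c ∈ primeIntegral p, C c * X ∈ liftsRing (primeIntegral p).subtype :=
    fun c hc => by
      rw [← lifts_iff_liftsRing]
      exact mul_mem (C_mem_lifts _ (⟨c, hc⟩ : primeIntegral p)) (X_mem_lifts _)
  choose! g hg e he hge using fun (i : ℕ) (hi0 : i ≠ 0) (hi : i < 2 * p) =>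
    exists_integral_part (p := p) hi0 hi (hlin a ha) (hlin b hb)
  set F : ℚ[X] := truncLog n (C a * X + C b * X + C a * X * (C b * X)) -
      truncLog n (C a * X) - truncLog n (C b * X) with hF
  have hsplit : F = ∑ j ∈ Finset.range n, (-1) ^ j * g (j + 1) +
      C ((∑ j ∈ Finset.range n, (-1) ^ j * e (j + 1)) / p * (a * b) ^ p) * X ^ (2 * p) := by
    have hlast : C ((∑ j ∈ Finset.range n, (-1) ^ j * e (j + 1)) / p * (a * b) ^ p) *
        X ^ (2 * p) = ∑ j ∈ Finset.range n,
          (-1) ^ j * (C (e (j + 1) / p) * (C a * X * (C b * X)) ^ p) := by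
      rw [Finset.sum_div, Finset.sum_mul, map_sum, Finset.sum_mul]
      refine Finset.sum_congr rfl fun j _ => ?_
      simp only [C_mul, C_pow, mul_div_assoc, C_neg, C_1]
      ring
    rw [hlast, ← Finset.sum_add_distrib, hF]
    simp only [truncLog]
    rw [← Finset.sum_sub_distrib, ← Finset.sum_sub_distrib]
    refine Finset.sum_congr rfl fun j hj => ?_
    have hj := Finset.mem_range.mp hj
    rw [← mul_add, ← hge (j + 1) (by omega) (by omega), Polynomial.algebraMap_eq, div_eq_mul_inv]
    simp only [C_mul, C_pow, C_neg, C_1]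
    push_cast
    ring
  set c := ∑ j ∈ Finset.range n, (-1) ^ j * e (j + 1) with hc
  have hcmem : c ∈ primeIntegral p := sum_mem fun j hj => by
    have hj := Finset.mem_range.mp hj
    exact mul_mem (pow_mem (neg_mem (one_mem _)) _) (he _ (by omega) (by omega))
  have hint : ∑ j ∈ Finset.range n, (-1) ^ j * g (j + 1) ∈
      liftsRing (primeIntegral p).subtype := sum_mem fun j hj => by
    have hj := Finset.mem_range.mp hj
    exact mul_mem (pow_mem (neg_mem (one_mem _)) _) (hg _ (by omega) (by omega))
  have hdvd : X ^ (n + 1) ∣ ∑ j ∈ Finset.range n, (-1) ^ j * g (j + 1) := by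
    rw [eq_sub_of_add_eq hsplit.symm]
    exact dvd_sub (X_pow_succ_dvd_truncLog_add n a b)
      ((pow_dvd_pow X (by omega)).mul_left _)
  have hcoeff : ∀ d, (∑ j ∈ Finset.range n, (-1) ^ j * g (j + 1)).coeff d ∈ primeIntegral p := by
    intro d
    rw [← lifts_iff_liftsRing, lifts_iff_coeff_lifts] at hint
    obtain ⟨s, hs⟩ := hint d
    exact hs ▸ s.2
  have heval : truncLog n ((p : ℚ) ^ 1 * a + (p : ℚ) ^ 1 * b + (p : ℚ) ^ 1 * a * ((p : ℚ) ^ 1 * b))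
      - truncLog n ((p : ℚ) ^ 1 * a) - truncLog n ((p : ℚ) ^ 1 * b) = F.eval (p : ℚ) := by
    simp only [hF, eval_sub, eval_truncLog, eval_add, eval_mul, eval_C, eval_X, pow_one]
    simp only [mul_comm (p : ℚ)]
  rw [heval, hsplit, eval_add]
  refine add_mem (eval_mem_primePowMultiples hcoeff hdvd) ?_
  refine mem_primePowMultiples.mpr ⟨c * (a * b) ^ p * (p : ℚ) ^ (2 * p - (n + 2)),
    mul_mem (mul_mem hcmem (pow_mem (mul_mem ha hb) _)) (pow_mem (natCast_mem _ _) _), ?_⟩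
  have hp0 : (p : ℚ) ≠ 0 := by exact_mod_cast hp.out.ne_zero
  have hpow : (p : ℚ) ^ (2 * p) = p ^ (n + 1) * p * p ^ (2 * p - (n + 2)) := by
    rw [← pow_succ, ← pow_add]; congr 1; omega
  simp only [eval_mul, eval_C, eval_pow, eval_X, hpow]
  field_simp

theorem prod_one_add_sub_one_mem {ι : Type*} (s : Finset ι) (f : ι → ℚ)
    (hf : ∀ i ∈ s, f i ∈ primePowMultiples p 1) :
    ∏ i ∈ s, (1 + f i) - 1 ∈ primePowMultiples p 1 := by
  classical
  induction s using Finset.induction_on with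
  | empty => simp
  | insert i s hi ih =>
    have h1 := hf i (Finset.mem_insert_self _ _)
    have h2 := ih fun j hj => hf j (Finset.mem_insert_of_mem hj)
    have h3 : (1 + f i) ∈ primeIntegral p := by
      obtain ⟨r, hr, h⟩ := h1
      exact h ▸ add_mem (one_mem _) (mul_mem (pow_mem (natCast_mem _ _) _) hr)
    rw [Finset.prod_insert hi]
    convert add_mem h1 (mul_mem_primePowMultiples h3 h2) using 1
    ring

theorem truncLog_prod_sub_sum_mem {n : ℕ} (hn : n + 2 ≤ 2 * p) {ι : Type*} (s : Finset ι)
    (f : ι → ℚ) (hf : ∀ i ∈ s, f i ∈ primePowMultiples p 1) :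
    truncLog n (∏ i ∈ s, (1 + f i) - 1) - ∑ i ∈ s, truncLog n (f i) ∈
      primePowMultiples p (n + 1) := by
  classical
  induction s using Finset.induction_on with
  | empty => simp [truncLog]
  | insert i s hi ih =>
    have h1 := hf i (Finset.mem_insert_self _ _)
    have h2 : ∀ j ∈ s, f j ∈ primePowMultiples p 1 := fun j hj => hf j (Finset.mem_insert_of_mem hj)
    have h3 := truncLog_add_mem hn h1 (prod_one_add_sub_one_mem s f h2)
    rw [Finset.prod_insert hi, Finset.sum_insert hi]
    convert add_mem h3 (ih h2) using 1
    rw [show (1 + f i) * ∏ j ∈ s, (1 + f j) - 1 = f i + (∏ j ∈ s, (1 + f j) - 1) +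
      f i * (∏ j ∈ s, (1 + f j) - 1) by ring]
    ring

end

section

variable {p : ℕ} [hp : Fact p.Prime]

theorem inv_two_mem_primeIntegral (hodd : Odd p) : (2 : ℚ)⁻¹ ∈ primeIntegral p := by
  have h : ¬ p ∣ 2 := fun h => by
    rw [(Nat.prime_dvd_prime_iff_eq hp.out Nat.prime_two).mp h] at hodd
    exact absurd hodd (by decide)
  exact_mod_cast inv_natCast_mem_primeIntegral h

theorem eulerPolyZero_mem_primeIntegral (hodd : Odd p) (m : ℕ) :
    eulerPolyZero m ∈ primeIntegral p := by
  induction m using Nat.strong_induction_on with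
  | _ m ih =>
    rcases eq_or_ne m 0 with rfl | hm
    · rw [eulerPolyZero_zero]; exact one_mem _
    · rw [eulerPolyZero_eq_sum hm, div_eq_mul_inv]
      exact mul_mem (neg_mem (sum_mem fun k hk =>
        mul_mem (natCast_mem _ _) (ih k (Finset.mem_range.mp hk))))
        (inv_two_mem_primeIntegral hodd)

theorem invariantCoeff_mem_primeIntegral (hodd : Odd p) {j : ℕ} (hj : j + 1 < 2 * p) :
    invariantCoeff j ∈ primeIntegral p := by
  by_cases h : p ∣ j + 1
  · have hjp : j + 1 = p := by
      obtain ⟨c, hc⟩ := h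
      have : c < 2 := by
        by_contra h2
        have := Nat.mul_le_mul_left p (not_lt.mp h2)
        omega
      interval_cases c <;> omega
    have hp0 : (p : ℚ) ≠ 0 := by exact_mod_cast hp.out.ne_zero
    have hjc : (j : ℚ) + 1 = p := by exact_mod_cast hjp
    have heq : invariantCoeff j =
        -∑ k ∈ Finset.range j, (p.choose (k + 1) / p : ℚ) * eulerPolyZero (k + 1) := by
      rw [invariantCoeff, hjc, eulerPolyZero_eq_sum (by omega), Finset.sum_range_succ',
        eulerPolyZero_zero, hjp, Nat.choose_zero_right]
      simp_rw [div_mul_eq_mul_div]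
      rw [← Finset.sum_div]
      field_simp
      push_cast
      ring
    rw [heq]
    refine neg_mem (sum_mem fun k hk => mul_mem ?_ (eulerPolyZero_mem_primeIntegral hodd _))
    have hk := Finset.mem_range.mp hk
    obtain ⟨c, hc⟩ := hp.out.dvd_choose_self (k := k + 1) (by omega) (by omega)
    rw [hc, Nat.cast_mul, mul_div_cancel_left₀ _ hp0]
    exact natCast_mem _ _
  · rw [invariantCoeff, div_eq_mul_inv]
    refine mul_mem (add_mem (one_mem _) (mul_mem ?_ (eulerPolyZero_mem_primeIntegral hodd _))) ?_
    · exact_mod_cast natCast_mem (primeIntegral p) 2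
    · exact_mod_cast inv_natCast_mem_primeIntegral h

/-- The truncation at order `n` of the power series with coefficients `invariantCoeff`. -/
def invariantSum (n : ℕ) (t : ℚ) : ℚ :=
  ∑ j ∈ Finset.range n, invariantCoeff j * t ^ (j + 1)

theorem invariantSum_reflect_sub_mem (hodd : Odd p) {n k : ℕ} (hn : n + 2 ≤ 2 * p) (hk0 : 0 < k)
    (hk : k < p) :
    invariantSum n (p / (p - k : ℕ)) - invariantSum n (p / k) ∈ primePowMultiples p (n + 1) := by
  have hkc : (k : ℚ) ≠ 0 := by positivity
  have hpk : (p : ℚ) - k ≠ 0 := sub_ne_zero.mpr (by exact_mod_cast hk.ne')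
  have hki : (k : ℚ)⁻¹ ∈ primeIntegral p :=
    inv_natCast_mem_primeIntegral (Nat.not_dvd_of_pos_of_lt hk0 hk)
  have hpki : ((p : ℚ) - k)⁻¹ ∈ primeIntegral p := by
    have := inv_natCast_mem_primeIntegral (p := p) (k := p - k)
      (Nat.not_dvd_of_pos_of_lt (by omega) (by omega))
    rwa [Nat.cast_sub hk.le] at this
  let t : primeIntegral p := ⟨p * (k : ℚ)⁻¹, mul_mem (natCast_mem _ _) hki⟩
  let w : primeIntegral p := ⟨-(k * ((p : ℚ) - k)⁻¹), neg_mem (mul_mem (natCast_mem _ _) hpki)⟩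
  let g : ℕ → primeIntegral p := fun j =>
    if hj : j + 1 < 2 * p then ⟨_, invariantCoeff_mem_primeIntegral hodd hj⟩ else 0
  have hgv : ∀ j < n, (g j : ℚ) = invariantCoeff j := fun j hj => by
    simp only [g]
    rw [dif_pos (by omega)]
  have hw : w * (1 - t) = 1 := by
    apply Subtype.ext
    simp only [w, t, MulMemClass.coe_mul, AddSubgroupClass.coe_sub, OneMemClass.coe_one]
    field_simp
    ring
  have htw : (-(t * w) : ℚ) = p / (p - k : ℕ) := by
    rw [Nat.cast_sub hk.le]
    simp only [w, t]
    field_simp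
  obtain ⟨c, hc⟩ := pow_succ_dvd_sum_sub_sum_of_invariant hw n g (by
    intro d hd
    apply Subtype.ext
    push_cast
    rw [hgv d hd, ← sum_neg_one_pow_mul_choose_mul_invariantCoeff]
    refine Finset.sum_congr rfl fun j hj => ?_
    rw [hgv j (by have := Finset.mem_range.mp hj; omega)])
  have hc' := congrArg Subtype.val hc
  push_cast at hc'
  rw [htw] at hc'
  refine mem_primePowMultiples.mpr ⟨(k : ℚ)⁻¹ ^ (n + 1) * c, mul_mem (pow_mem hki _) c.2, ?_⟩
  rw [← mul_assoc, ← mul_pow]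
  refine hc'.symm.trans ?_
  rw [invariantSum, invariantSum, div_eq_mul_inv (p : ℚ) (k : ℚ)]
  congr 1 <;> exact Finset.sum_congr rfl fun j hj => by rw [hgv j (Finset.mem_range.mp hj)]

theorem sum_invariantSum_sub_mem (hodd : Odd p) {n m : ℕ} (hn : n + 2 ≤ 2 * p)
    (hm : p = 2 * m + 1) :
    ∑ k ∈ Finset.Icc 1 m, invariantSum n (p / k) -
      ∑ k ∈ Finset.Icc 1 m, invariantSum n (p / (2 * k : ℕ)) ∈ primePowMultiples p (n + 1) := by
  have h := sum_Icc_add_reflect_eq (fun k => invariantSum n (p / k)) m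
  rw [← hm] at h
  have h1 : ∑ k ∈ Finset.Icc 1 m, (invariantSum n (p / (p - k : ℕ)) - invariantSum n (p / k)) ∈
      primePowMultiples p (n + 1) := sum_mem fun k hk => by
    rw [Finset.mem_Icc] at hk
    exact invariantSum_reflect_sub_mem hodd hn (by omega) (by omega)
  have h2 : ∑ k ∈ Finset.Icc 1 m,
      (invariantSum n (p / (p - 2 * k : ℕ)) - invariantSum n (p / (2 * k : ℕ))) ∈
      primePowMultiples p (n + 1) := sum_mem fun k hk => by
    rw [Finset.mem_Icc] at hk
    exact invariantSum_reflect_sub_mem hodd hn (by omega) (by omega)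
  convert mul_mem_primePowMultiples (inv_two_mem_primeIntegral hodd) (sub_mem h2 h1) using 1
  simp only [Finset.sum_add_distrib, Finset.sum_sub_distrib] at h ⊢
  linarith

theorem four_pow_mul_prod_eq (m : ℕ) :
    (4 : ℚ) ^ m * ∏ k ∈ Finset.Icc 1 m, (1 + -((2 * m + 1 : ℕ) / (2 * k : ℕ) : ℚ)) =
      ∏ k ∈ Finset.Icc 1 m, (1 + -((2 * m + 1 : ℕ) / (k : ℕ) : ℚ)) := by
  have h := prod_Icc_mul_reflect_eq (fun k => (k : ℚ)) m
  have hne : ∏ k ∈ Finset.Icc 1 m, (-(k : ℚ) ^ 2) ≠ 0 := Finset.prod_ne_zero_iff.mpr fun k hk => by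
    have : (k : ℚ) ≠ 0 := by
      have := (Finset.mem_Icc.mp hk).1
      positivity
    simpa using this
  apply mul_left_cancel₀ hne
  have hcard : (4 : ℚ) ^ m = ∏ k ∈ Finset.Icc 1 m, (4 : ℚ) := by simp
  rw [hcard, ← Finset.prod_mul_distrib, ← Finset.prod_mul_distrib, ← Finset.prod_mul_distrib]
  refine (Eq.trans ?_ h.symm).trans ?_
  · refine Finset.prod_congr rfl fun k hk => ?_
    rw [Finset.mem_Icc] at hk
    have hk0 : (k : ℚ) ≠ 0 := by have := hk.1; positivity
    rw [Nat.cast_sub (by omega)]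
    push_cast
    field_simp
    ring
  · refine Finset.prod_congr rfl fun k hk => ?_
    rw [Finset.mem_Icc] at hk
    have hk0 : (k : ℚ) ≠ 0 := by have := hk.1; positivity
    rw [Nat.cast_sub (by omega)]
    push_cast
    field_simp
    ring

theorem truncLog_two_pow_sub_mem (hodd : Odd p) {n m : ℕ} (hn : n + 2 ≤ 2 * p)
    (hm : p = 2 * m + 1) :
    truncLog n ((2 : ℚ) ^ (p - 1) - 1) + ∑ k ∈ Finset.Icc 1 m, truncLog n (-(p / (2 * k : ℕ) : ℚ)) -
      ∑ k ∈ Finset.Icc 1 m, truncLog n (-(p / k : ℚ)) ∈ primePowMultiples p (n + 1) := by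
  have hmem : ∀ k : ℕ, 0 < k → k < p → -(p / k : ℚ) ∈ primePowMultiples p 1 := fun k h0 hk =>
    mem_primePowMultiples.mpr ⟨-(k : ℚ)⁻¹, neg_mem (inv_natCast_mem_primeIntegral
      (Nat.not_dvd_of_pos_of_lt h0 hk)), by rw [pow_one]; ring⟩
  have hf1 : ∀ k ∈ Finset.Icc 1 m, -(p / k : ℚ) ∈ primePowMultiples p 1 := fun k hk => by
    rw [Finset.mem_Icc] at hk
    exact hmem k (by omega) (by omega)
  have hf2 : ∀ k ∈ Finset.Icc 1 m, -(p / (2 * k : ℕ) : ℚ) ∈ primePowMultiples p 1 :=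
    fun k hk => by
      rw [Finset.mem_Icc] at hk
      exact hmem (2 * k) (by omega) (by omega)
  have hq : (2 : ℚ) ^ (p - 1) - 1 ∈ primePowMultiples p 1 := by
    have hcop : IsCoprime (2 : ℤ) p := by
      rw [← Nat.cast_ofNat, Nat.isCoprime_iff_coprime]
      exact hodd.coprime_two_left
    obtain ⟨c, hc⟩ := (Int.ModEq.pow_card_sub_one_eq_one hp.out hcop).symm.dvd
    refine mem_primePowMultiples.mpr ⟨c, intCast_mem _ _, ?_⟩
    rw [pow_one]
    exact_mod_cast hc.symm
  have h1 := truncLog_prod_sub_sum_mem hn _ _ hf1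
  have h2 := truncLog_prod_sub_sum_mem hn _ _ hf2
  have h3 := truncLog_add_mem hn hq (prod_one_add_sub_one_mem _ _ hf2)
  have hfour : (2 : ℚ) ^ (p - 1) = 4 ^ m := by
    rw [show p - 1 = 2 * m by omega, pow_mul]; norm_num
  have hprod := four_pow_mul_prod_eq m
  rw [← hm, ← hfour] at hprod
  convert sub_mem (sub_mem h1 h2) h3 using 1
  rw [← hprod]
  have : ∀ a b : ℚ, a - 1 + (b - 1) + (a - 1) * (b - 1) = a * b - 1 := fun a b => by ring
  rw [this]
  ring

end

/-- The sum of the main theorem, multiplied by `p`, in terms of `truncLog` and `invariantSum`. -/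
theorem mul_bernoulli_sum_add_fermatQuotient_sum_eq {p : ℕ} (hp0 : p ≠ 0) (n m : ℕ) :
    (p : ℚ) * ((∑ j ∈ Finset.range n,
          ((2 : ℚ) ^ (j + 1) - 1) / ((j : ℚ) + 1) * (((2 : ℚ) ^ (j + 2) - 1) / ((j : ℚ) + 2)) *
            (bernoulli (j + 2) / (2 : ℚ) ^ ((j : ℤ) - 1)) *
            genHarmonic (j + 1) m * (p : ℚ) ^ j) +
        ∑ j ∈ Finset.range n,
          (-1 : ℚ) ^ j * (fermatQuotientTwo p ^ (j + 1) / ((j : ℚ) + 1)) * (p : ℚ) ^ j) =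
      (truncLog n ((2 : ℚ) ^ (p - 1) - 1) +
        ∑ k ∈ Finset.Icc 1 m, truncLog n (-(p / (2 * k : ℕ) : ℚ)) -
        ∑ k ∈ Finset.Icc 1 m, truncLog n (-(p / k : ℚ))) -
      (∑ k ∈ Finset.Icc 1 m, invariantSum n (p / k) -
        ∑ k ∈ Finset.Icc 1 m, invariantSum n (p / (2 * k : ℕ))) := by
  have hpc : (p : ℚ) ≠ 0 := by exact_mod_cast hp0
  have hlog : (p : ℚ) * ∑ j ∈ Finset.range n,
      (-1 : ℚ) ^ j * (fermatQuotientTwo p ^ (j + 1) / ((j : ℚ) + 1)) * (p : ℚ) ^ j =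
      truncLog n ((2 : ℚ) ^ (p - 1) - 1) := by
    rw [truncLog, Finset.mul_sum]
    refine Finset.sum_congr rfl fun j _ => ?_
    have hq : (2 : ℚ) ^ (p - 1) - 1 = p * fermatQuotientTwo p := by
      rw [fermatQuotientTwo]; field_simp
    rw [hq, Algebra.algebraMap_self, RingHom.id_apply, mul_pow]
    ring
  have hker : ∀ t : ℚ, truncLog n (-t) + invariantSum n t =
      ∑ j ∈ Finset.range n, 2 * eulerPolyZero (j + 1) / (j + 1) * t ^ (j + 1) := fun t => by
    rw [truncLog, invariantSum, ← Finset.sum_add_distrib]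
    refine Finset.sum_congr rfl fun j _ => ?_
    have h1 : (-1 : ℚ) ^ j * (-1) ^ j = 1 := by rw [← mul_pow]; simp
    rw [Algebra.algebraMap_self, RingHom.id_apply, invariantCoeff, neg_pow t, pow_succ (-1 : ℚ)]
    linear_combination -(t ^ (j + 1) / (j + 1)) * h1
  have hharm : (p : ℚ) * ∑ j ∈ Finset.range n,
          ((2 : ℚ) ^ (j + 1) - 1) / ((j : ℚ) + 1) * (((2 : ℚ) ^ (j + 2) - 1) / ((j : ℚ) + 2)) *
            (bernoulli (j + 2) / (2 : ℚ) ^ ((j : ℤ) - 1)) *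
            genHarmonic (j + 1) m * (p : ℚ) ^ j =
      ∑ k ∈ Finset.Icc 1 m,
        ((truncLog n (-(p / (2 * k : ℕ) : ℚ)) + invariantSum n (p / (2 * k : ℕ))) -
          (truncLog n (-(p / k : ℚ)) + invariantSum n (p / k))) := by
    simp_rw [hker, ← Finset.sum_sub_distrib]
    rw [Finset.sum_comm, Finset.mul_sum]
    refine Finset.sum_congr rfl fun j _ => ?_
    rw [genHarmonic, Finset.mul_sum, Finset.sum_mul, Finset.mul_sum]
    refine Finset.sum_congr rfl fun k hk => ?_
    have hk0 : (k : ℚ) ≠ 0 := by have := (Finset.mem_Icc.mp hk).1; positivity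
    have hj1 : (j : ℚ) + 1 ≠ 0 := by positivity
    have hj2 : (j : ℚ) + 2 ≠ 0 := by positivity
    have hj3 : (j : ℚ) + 1 + 1 ≠ 0 := by positivity
    rw [eulerPolyZero, zpow_sub₀ two_ne_zero, zpow_natCast, zpow_one]
    push_cast
    rw [div_pow, div_pow, mul_pow, show (j : ℚ) + 1 + 1 = j + 2 by ring]
    field_simp
    ring
  rw [mul_add, hlog, hharm]
  simp only [Finset.sum_add_distrib, Finset.sum_sub_distrib]
  ring

theorem mainTheorem1 (p n : ℕ) (hp : p.Prime) (hodd : Odd p) (hn : 1 ≤ n)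
    (hpn : ((n : ℚ) + 1) / 2 < (p : ℚ)) :
    RatModEqPrimePow p n
      ((∑ j ∈ Finset.range n,
          ((2 : ℚ) ^ (j + 1) - 1) / ((j : ℚ) + 1) * (((2 : ℚ) ^ (j + 2) - 1) / ((j : ℚ) + 2)) *
            (bernoulli (j + 2) / (2 : ℚ) ^ ((j : ℤ) - 1)) *
            genHarmonic (j + 1) ((p - 1) / 2) * (p : ℚ) ^ j) +
        ∑ j ∈ Finset.range n,
          (-1 : ℚ) ^ j * (fermatQuotientTwo p ^ (j + 1) / ((j : ℚ) + 1)) * (p : ℚ) ^ j)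
      0 := by
  have : Fact p.Prime := ⟨hp⟩
  have hn2 : n + 2 ≤ 2 * p := by
    rw [div_lt_iff₀ two_pos] at hpn
    have : n + 1 < p * 2 := by exact_mod_cast hpn
    omega
  have hm : p = 2 * ((p - 1) / 2) + 1 := by
    have := Nat.odd_iff.mp hodd
    omega
  have hpc : (p : ℚ) ≠ 0 := by exact_mod_cast hp.ne_zero
  have hmem := sub_mem (truncLog_two_pow_sub_mem hodd hn2 hm) (sum_invariantSum_sub_mem hodd hn2 hm)
  rw [← mul_bernoulli_sum_add_fermatQuotient_sum_eq hp.ne_zero] at hmem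
  obtain ⟨_, ⟨a, b, hb, rfl⟩, hs⟩ := mem_primePowMultiples.mp hmem
  refine ⟨a, b, hb, ?_⟩
  rw [sub_zero]
  apply mul_left_cancel₀ hpc
  rw [← hs]
  ring
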